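/- Let $(Y,\mu)$ be a probability space. For a measurable function $f$ on $Y$ with values in $\mathbb R$ or $\mathbb C$ put $$d_f(\lambda)=\mu(\{y\in Y:|f(y)|>\lambda\}),\qquad f^*(t)=\inf\{\lambda>0: d_f(\lambda)\le t\},$$ and, for $p\in(1,\infty)$ and $q\in[1,\infty]$, $$\|f\|_{L^{p,q}}=\Big(\int_0^\infty\big(t^{1/p}f^*(t)\big)^q\,\frac{dt}{t}\Big)^{1/q}\ \text{ if } q<\infty,\qquad \|f\|_{L^{p,\infty}}=\sup_{t>0}t^{1/p}f^*(t),$$ with values in $[0,\infty]$. **Theorem (Marcinkiewicz–Zygmund inequality in Lorentz spaces).** For every $p\in(1,\infty)$ and $q\in[1,\infty]$ there is a constant $C>0$, depending only on $p$ and $q$, such that for every probability space $(Y,\mu)$, every $N$, and all independent integrable real- or complex-valued random variables $X_1,\dots,X_N$ on $(Y,\mu)$ with $\mathbb E[X_n]=0$ for all $n$, we have $$\Big\|\sum_{n=1}^N X_n\Big\|_{L^{p,q}}\le C\,\Big\|\Big(\sum_{n=1}^N|X_n|^2\Big)^{1/2}\Big\|_{L^{p,q}}\quad\text{and}\quad \Big\|\Big(\sum_{n=1}^N|X_n|^2\Big)^{1/2}\Big\|_{L^{p,q}}\le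 C\,\Big\|\sum_{n=1}^N X_n\Big\|_{L^{p,q}}.$$ The inequalities hold in $[0,\infty]$; in particular, one of the two norms is finite if and only if the other is. -/

import Mathlib

open MeasureTheory ProbabilityTheory
open scoped ENNReal NNReal

noncomputable section

namespace LorentzMZ

/-- The distribution function `d_f(l) = μ {x | |f x| > l}`. -/
def distFun {Ω E : Type*} [MeasurableSpace Ω] [NormedAddCommGroup E]
    (f : Ω → E) (μ : Measure Ω) (l : ℝ≥0) : ℝ≥0∞ :=
  μ {x | (l : ℝ) < ‖f x‖}

/-- The non-increasing rearrangement `f^*(t) = inf {l > 0 | d_f(l) ≤ t}`, with values in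
`[0, ∞]` (the infimum of the empty set is `∞`). -/
def rearrangement {Ω E : Type*} [MeasurableSpace Ω] [NormedAddCommGroup E]
    (f : Ω → E) (μ : Measure Ω) (t : ℝ) : ℝ≥0∞ :=
  ⨅ (l : ℝ≥0) (_ : 0 < l ∧ distFun f μ l ≤ ENNReal.ofReal t), (l : ℝ≥0∞)

/-- The Lorentz norm `‖f‖_{L^{p,q}}`, with values in `[0, ∞]`:
`(∫_0^∞ (t^{1/p} f^*(t))^q dt/t)^{1/q}` if `q < ∞`, and `sup_{t > 0} t^{1/p} f^*(t)` if
`q = ∞`. -/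
def lorentzNorm {Ω E : Type*} [MeasurableSpace Ω] [NormedAddCommGroup E]
    (f : Ω → E) (p : ℝ) (q : ℝ≥0∞) (μ : Measure Ω) : ℝ≥0∞ :=
  if q = ∞ then
    ⨆ (t : ℝ) (_ : 0 < t), ENNReal.ofReal (t ^ (1 / p)) * rearrangement f μ t
  else
    (∫⁻ t in Set.Ioi (0 : ℝ),
      (ENNReal.ofReal (t ^ (1 / p)) * rearrangement f μ t) ^ q.toReal / ENNReal.ofReal t)
        ^ (1 / q.toReal)

end LorentzMZ

end

/-! Write S for the sum and Q for the square function. Jensen's inequality for the convex function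
(|x| - l)₊ shows that dropping some of the independent centred summands does not increase its
expectation. Hence a change of signs costs only a factor 2 and a doubling of the level l, and it can
be undone at the same price. After averaging over all choices of signs, Khintchine's inequality
applies at each point ω, and Markov's inequality turns the result into two distributional bounds
with φ(u) = min(u, u^(2k)): d_S(3l) ≤ C ∫ φ(Q/l) (`distFun_sum_le`) and d_Q(3Ml) ≤ C ∫ φ(|S|/l)
(`distFun_squareFun_le`).

A bound of this form carries endpoint information at the exponents 1 and 2k, so for 1 < p < 2k it
gives an estimate in L^{p,q} (`lorentzNorm_le_of_weakType`). To see this, cut the integral into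
dyadic shells: d_f(l) is at most a sum over k of 2^{kp} d_g(2^k l) with weights decaying
geometrically in |k|. The Lorentz norm, written through the distribution function, scales so that
2^{kp} exactly cancels the dilation by 2^k, and the weights sum. Everything takes place in [0, ∞],
so no finiteness of the norms is needed. -/

namespace LorentzMZ

/-! ### Sign changes encoded by subsets -/

section Signs

variable {ι E : Type*} [DecidableEq ι] [AddCommGroup E]

/-- The sum over `s` of the terms `a n`, with the signs of those outside `A` reversed. -/
def signedSum (s A : Finset ι) (a : ι → E) : E :=
  ∑ n ∈ s, if n ∈ A then a n else -a n

lemma signedSum_eq_sub [Fintype ι] (A : Finset ι) (a : ι → E) :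
    signedSum Finset.univ A a = ∑ n ∈ A, a n - ∑ n ∈ Aᶜ, a n := by
  rw [signedSum, ← Finset.sum_add_sum_compl A, sub_eq_add_neg, ← Finset.sum_neg_distrib]
  congr 1
  · exact Finset.sum_congr rfl fun n hn => by simp [hn]
  · exact Finset.sum_congr rfl fun n hn => by simp [Finset.mem_compl.1 hn]

lemma signedSum_signed [Fintype ι] (A : Finset ι) (a : ι → E) :
    signedSum Finset.univ A (fun n => if n ∈ A then a n else -a n) = ∑ n, a n :=
  Finset.sum_congr rfl fun n _ => by by_cases h : n ∈ A <;> simp [h]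

end Signs

/-! ### Truncated first moments under deletion and sign changes -/

section Contraction

variable {𝕜 Ω : Type*} [RCLike 𝕜] [MeasurableSpace Ω] {μ : Measure Ω} [IsProbabilityMeasure μ]

/-- By independence the joint law is a product. With U = x fixed, x + V has mean x, so ‖x‖ is at
most the mean of ‖x + V‖. Subtracting l inside the integral gives Jensen's inequality for the
truncated norm. -/
lemma lintegral_enorm_tsub_le_of_indepFun {U V : Ω → 𝕜} (hU : Integrable U μ)
    (hV : Integrable V μ) (h : IndepFun U V μ) (h0 : ∫ ω, V ω ∂μ = 0) (l : ℝ≥0∞) :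
    ∫⁻ ω, (‖U ω‖ₑ - l) ∂μ ≤ ∫⁻ ω, (‖U ω + V ω‖ₑ - l) ∂μ := by
  have mU := hU.aestronglyMeasurable.aemeasurable
  have mV := hV.aestronglyMeasurable.aemeasurable
  have : IsProbabilityMeasure (μ.map U) := Measure.isProbabilityMeasure_map mU
  have : IsProbabilityMeasure (μ.map V) := Measure.isProbabilityMeasure_map mV
  have hmeas : Measurable fun z : 𝕜 × 𝕜 => ‖z.1 + z.2‖ₑ - l := by fun_prop
  have hid : Integrable (fun y : 𝕜 => y) (μ.map V) :=
    (integrable_map_measure (by fun_prop) mV).2 hV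
  have hint : ∫ y, y ∂(μ.map V) = 0 := by
    rw [integral_map mV (by fun_prop)]; exact h0
  calc ∫⁻ ω, (‖U ω‖ₑ - l) ∂μ = ∫⁻ x, (‖x‖ₑ - l) ∂(μ.map U) := by
        rw [lintegral_map' (by fun_prop) mU]
    _ ≤ ∫⁻ x, ∫⁻ y, (‖x + y‖ₑ - l) ∂(μ.map V) ∂(μ.map U) := by
        refine lintegral_mono fun x => ?_
        have hx : ∫ y, x + y ∂(μ.map V) = x := by
          rw [integral_add (integrable_const _) hid, hint]; simp
        calc ‖x‖ₑ - l ≤ ∫⁻ y, ‖x + y‖ₑ ∂(μ.map V) - ∫⁻ _, l ∂(μ.map V) := by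
              rw [lintegral_const, measure_univ, mul_one]
              refine tsub_le_tsub_right ?_ _
              conv_lhs => rw [← hx]
              exact enorm_integral_le_lintegral_enorm _
          _ ≤ _ := lintegral_sub_le _ _ measurable_const
    _ = ∫⁻ z, (‖z.1 + z.2‖ₑ - l) ∂((μ.map U).prod (μ.map V)) :=
        (lintegral_prod _ hmeas.aemeasurable).symm
    _ = ∫⁻ ω, (‖U ω + V ω‖ₑ - l) ∂μ := by
        rw [← (indepFun_iff_map_prod_eq_prod_map_map mU mV).1 h,
          lintegral_map' hmeas.aemeasurable (mU.prodMk mV)]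

variable {ι : Type*} [Fintype ι] [DecidableEq ι] {X : ι → Ω → 𝕜}

lemma lintegral_enorm_sum_finset_tsub_le (h : iIndepFun X μ) (hint : ∀ n, Integrable (X n) μ)
    (h0 : ∀ n, ∫ ω, X n ω ∂μ = 0) (A : Finset ι) (l : ℝ≥0∞) :
    ∫⁻ ω, (‖∑ n ∈ A, X n ω‖ₑ - l) ∂μ ≤ ∫⁻ ω, (‖∑ n, X n ω‖ₑ - l) ∂μ := by
  have hind : IndepFun (fun ω => ∑ n ∈ A, X n ω) (fun ω => ∑ n ∈ Aᶜ, X n ω) μ := by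
    have := (h.indepFun_finset₀ A Aᶜ disjoint_compl_right
      fun n => (hint n).aestronglyMeasurable.aemeasurable).comp
      (φ := fun z => ∑ i, z i) (ψ := fun z => ∑ i, z i) (by fun_prop) (by fun_prop)
    convert this using 1
    · ext ω; exact (Finset.sum_coe_sort A fun n => X n ω).symm
    · ext ω; exact (Finset.sum_coe_sort Aᶜ fun n => X n ω).symm
  refine (lintegral_enorm_tsub_le_of_indepFun (integrable_finsetSum _ fun n _ => hint n)
    (integrable_finsetSum _ fun n _ => hint n) hind ?_ l).trans_eq ?_
  · rw [integral_finsetSum _ fun n _ => hint n]; simp [h0]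
  · simp only [Finset.sum_add_sum_compl]

/-- The signed sum is a difference of two sub-sums, and (a + b - 2l)₊ ≤ (a - l)₊ + (b - l)₊. Each
sub-sum is dominated by the full sum, whence the factor 2 and the level 2l. -/
lemma lintegral_enorm_signedSum_tsub_le (h : iIndepFun X μ) (hint : ∀ n, Integrable (X n) μ)
    (h0 : ∀ n, ∫ ω, X n ω ∂μ = 0) (A : Finset ι) (l : ℝ≥0∞) :
    ∫⁻ ω, (‖signedSum Finset.univ A (X · ω)‖ₑ - 2 * l) ∂μ ≤
      2 * ∫⁻ ω, (‖∑ n, X n ω‖ₑ - l) ∂μ := by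
  have hm : ∀ B : Finset ι, AEMeasurable (fun ω => ‖∑ n ∈ B, X n ω‖ₑ - l) μ := fun B => by
    have := fun n => (hint n).aestronglyMeasurable.aemeasurable
    fun_prop
  calc _ ≤ ∫⁻ ω, ((‖∑ n ∈ A, X n ω‖ₑ - l) + (‖∑ n ∈ Aᶜ, X n ω‖ₑ - l)) ∂μ := by
        refine lintegral_mono fun ω => ?_
        rw [signedSum_eq_sub, two_mul]
        exact (tsub_le_tsub_right (enorm_sub_le) _).trans add_tsub_add_le_tsub_add_tsub
    _ ≤ _ := by
        rw [lintegral_add_left' (hm A), two_mul]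
        exact add_le_add (lintegral_enorm_sum_finset_tsub_le h hint h0 A l)
          (lintegral_enorm_sum_finset_tsub_le h hint h0 Aᶜ l)

/-- Flipping signs is an involution that preserves independence, integrability and zero mean, so the
previous bound applies to the flipped family. -/
lemma lintegral_enorm_sum_tsub_le (h : iIndepFun X μ) (hint : ∀ n, Integrable (X n) μ)
    (h0 : ∀ n, ∫ ω, X n ω ∂μ = 0) (A : Finset ι) (l : ℝ≥0∞) :
    ∫⁻ ω, (‖∑ n, X n ω‖ₑ - 2 * l) ∂μ ≤
      2 * ∫⁻ ω, (‖signedSum Finset.univ A (X · ω)‖ₑ - l) ∂μ := by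
  have hY := lintegral_enorm_signedSum_tsub_le (μ := μ)
    (X := fun n ω => if n ∈ A then X n ω else -X n ω) ?_ ?_ ?_ A l
  · simp only [signedSum_signed] at hY; exact hY
  · refine h.comp (fun n x => if n ∈ A then x else -x) fun n => ?_
    by_cases hn : n ∈ A <;> simp only [hn, if_true, if_false] <;> fun_prop
  · intro n
    by_cases hn : n ∈ A <;> simp only [hn, if_true, if_false]
    exacts [hint n, (hint n).neg]
  · intro n
    by_cases hn : n ∈ A <;> simp [hn, integral_neg, h0]

end Contraction

/-! ### Khintchine's inequality for scalar families -/

section Khintchine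

variable {ι : Type*} [DecidableEq ι]

/-- The subsets of `insert i s` pair off as A and `insert i A`. This is the induction step for every
average over signs below. -/
lemma sum_powerset_insert_signedSum {E : Type*} [AddCommGroup E] {s : Finset ι} {i : ι}
    (hi : i ∉ s) (a : ι → E) (F : E → ℝ) :
    ∑ A ∈ (insert i s).powerset, F (signedSum (insert i s) A a) =
      ∑ A ∈ s.powerset, (F (signedSum s A a + a i) + F (signedSum s A a - a i)) := by
  rw [Finset.sum_powerset_insert hi, add_comm, ← Finset.sum_add_distrib]
  refine Finset.sum_congr rfl fun A hA => ?_
  have hiA : i ∉ A := fun h => hi (Finset.mem_powerset.1 hA h)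
  congr 2
  · rw [signedSum, Finset.sum_insert hi, add_comm]
    simp only [Finset.mem_insert_self, if_true, signedSum]
    congr 1
    refine Finset.sum_congr rfl fun n hn => ?_
    have : n ≠ i := fun h => hi (h ▸ hn)
    simp [this]
  · rw [signedSum, Finset.sum_insert hi, add_comm, if_neg hiA, ← sub_eq_add_neg]
    rfl

variable {𝕜 : Type*} [RCLike 𝕜]

lemma sum_norm_sq_signedSum (s : Finset ι) (a : ι → 𝕜) :
    ∑ A ∈ s.powerset, ‖signedSum s A a‖ ^ 2 = 2 ^ s.card * ∑ n ∈ s, ‖a n‖ ^ 2 := by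
  induction s using Finset.induction_on with
  | empty => simp [signedSum]
  | insert i s hi ih =>
    have h : ∀ A, ‖signedSum s A a + a i‖ ^ 2 + ‖signedSum s A a - a i‖ ^ 2 =
        2 * ‖signedSum s A a‖ ^ 2 + 2 * ‖a i‖ ^ 2 := fun A => by
      have := parallelogram_law_with_norm 𝕜 (signedSum s A a) (a i)
      linarith
    rw [sum_powerset_insert_signedSum hi a (fun x => ‖x‖ ^ 2), Finset.sum_congr rfl fun A _ => h A,
      Finset.sum_add_distrib, ← Finset.mul_sum, ih, Finset.sum_const, Finset.card_powerset,
      Finset.card_insert_of_notMem hi, Finset.sum_insert hi, nsmul_eq_mul]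
    push_cast
    ring

/-- This is the moment generating function of a Rademacher sum; cosh replaces exp because the signs
are symmetric. -/
lemma sum_cosh_signedSum (s : Finset ι) (a : ι → ℝ) :
    ∑ A ∈ s.powerset, Real.cosh (signedSum s A a) = 2 ^ s.card * ∏ n ∈ s, Real.cosh (a n) := by
  induction s using Finset.induction_on with
  | empty => simp [signedSum]
  | insert i s hi ih =>
    have h : ∀ A, Real.cosh (signedSum s A a + a i) + Real.cosh (signedSum s A a - a i) =
        Real.cosh (signedSum s A a) * (2 * Real.cosh (a i)) := fun A => by
      rw [Real.cosh_add, Real.cosh_sub]; ring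
    rw [sum_powerset_insert_signedSum hi a Real.cosh, Finset.sum_congr rfl fun A _ => h A,
      ← Finset.sum_mul, ih, Finset.card_insert_of_notMem hi, Finset.prod_insert hi]
    ring

lemma pow_le_factorial_mul_cosh (k : ℕ) (x : ℝ) :
    x ^ (2 * k) ≤ 2 * (2 * k).factorial * Real.cosh x := by
  have h := Real.pow_div_factorial_le_exp |x| (abs_nonneg x) (2 * k)
  have h' : Real.exp |x| ≤ 2 * Real.cosh x := by
    rw [← Real.cosh_abs, Real.cosh_eq]
    linarith [Real.exp_pos (-|x|)]
  have hf : (0 : ℝ) < (2 * k).factorial := by positivity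
  rw [div_le_iff₀ hf, pow_mul, sq_abs, ← pow_mul] at h
  nlinarith

/-- The constant in the Khintchine inequality of exponent `2 * k`. -/
noncomputable def khintchineConst (k : ℕ) : ℝ := 2 ^ k * (4 * (2 * k).factorial * Real.exp (1 / 2))

lemma khintchineConst_pos (k : ℕ) : 0 < khintchineConst k := by
  unfold khintchineConst; positivity

/-- The sub-Gaussian argument: even powers are dominated by cosh, whose average factors, and cosh x
≤ exp(x²/2). -/
lemma sum_pow_signedSum_le (k : ℕ) (s : Finset ι) {a : ι → ℝ} (ha : ∑ n ∈ s, a n ^ 2 ≤ 1) :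
    ∑ A ∈ s.powerset, signedSum s A a ^ (2 * k) ≤
      2 ^ s.card * (2 * (2 * k).factorial * Real.exp (1 / 2)) := by
  calc _ ≤ ∑ A ∈ s.powerset, 2 * (2 * k).factorial * Real.cosh (signedSum s A a) :=
        Finset.sum_le_sum fun A _ => pow_le_factorial_mul_cosh k _
    _ = 2 ^ s.card * (2 * (2 * k).factorial * ∏ n ∈ s, Real.cosh (a n)) := by
        rw [← Finset.mul_sum, sum_cosh_signedSum]; ring
    _ ≤ _ := by
        gcongr
        calc ∏ n ∈ s, Real.cosh (a n) ≤ ∏ n ∈ s, Real.exp (a n ^ 2 / 2) :=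
              Finset.prod_le_prod (fun n _ => (Real.cosh_pos _).le)
                fun n _ => Real.cosh_le_exp_half_sq _
          _ ≤ _ := by
              rw [← Real.exp_sum, ← Finset.sum_div]
              gcongr

lemma map_signedSum {E F : Type*} [AddCommGroup E] [AddCommGroup F] (f : E →+ F)
    (s A : Finset ι) (a : ι → E) : f (signedSum s A a) = signedSum s A (fun n => f (a n)) := by
  simp only [signedSum, map_sum, apply_ite f, map_neg]

lemma sum_norm_pow_signedSum_le_of_le_one (k : ℕ) (s : Finset ι) {a : ι → 𝕜}
    (ha : ∑ n ∈ s, ‖a n‖ ^ 2 ≤ 1) :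
    ∑ A ∈ s.powerset, ‖signedSum s A a‖ ^ (2 * k) ≤ 2 ^ s.card * khintchineConst k := by
  have hre : ∑ n ∈ s, RCLike.re (a n) ^ 2 ≤ 1 := le_trans (Finset.sum_le_sum fun n _ => by
    rw [RCLike.norm_sq_eq_def]; nlinarith [sq_nonneg (RCLike.im (a n))]) ha
  have him : ∑ n ∈ s, RCLike.im (a n) ^ 2 ≤ 1 := le_trans (Finset.sum_le_sum fun n _ => by
    rw [RCLike.norm_sq_eq_def]; nlinarith [sq_nonneg (RCLike.re (a n))]) ha
  have key : ∀ z : 𝕜, ‖z‖ ^ (2 * k) ≤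
      2 ^ k * (RCLike.re z ^ (2 * k) + RCLike.im z ^ (2 * k)) := fun z => by
    rw [pow_mul, RCLike.norm_sq_eq_def, ← sq, ← sq, pow_mul, pow_mul]
    refine (add_pow_le (sq_nonneg _) (sq_nonneg _) k).trans ?_
    gcongr
    · norm_num
    · omega
  calc _ ≤ ∑ A ∈ s.powerset, 2 ^ k * (RCLike.re (signedSum s A a) ^ (2 * k) +
        RCLike.im (signedSum s A a) ^ (2 * k)) := Finset.sum_le_sum fun A _ => key _
    _ = 2 ^ k * (∑ A ∈ s.powerset, signedSum s A (fun n => RCLike.re (a n)) ^ (2 * k) +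
        ∑ A ∈ s.powerset, signedSum s A (fun n => RCLike.im (a n)) ^ (2 * k)) := by
        rw [← Finset.mul_sum, Finset.sum_add_distrib]
        simp only [map_signedSum]
    _ ≤ 2 ^ k * (2 ^ s.card * (2 * (2 * k).factorial * Real.exp (1 / 2)) +
        2 ^ s.card * (2 * (2 * k).factorial * Real.exp (1 / 2))) := by
        gcongr
        exacts [sum_pow_signedSum_le k s hre, sum_pow_signedSum_le k s him]
    _ = _ := by rw [khintchineConst]; ring

lemma sum_norm_pow_signedSum_le {k : ℕ} (s : Finset ι) (a : ι → 𝕜) {r : ℝ} (hr : 0 < r)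
    (ha : ∑ n ∈ s, ‖a n‖ ^ 2 = r ^ 2) :
    ∑ A ∈ s.powerset, ‖signedSum s A a‖ ^ (2 * k) ≤
      2 ^ s.card * khintchineConst k * r ^ (2 * k) := by
  have h1 : ∑ n ∈ s, ‖((r⁻¹ : ℝ) : 𝕜) * a n‖ ^ 2 ≤ 1 := by
    simp only [norm_mul, mul_pow, ← Finset.mul_sum, ha, RCLike.norm_ofReal, sq_abs]
    rw [← mul_pow, inv_mul_cancel₀ hr.ne', one_pow]
  have h2 := sum_norm_pow_signedSum_le_of_le_one k s h1
  have h3 : ∀ A, ‖signedSum s A (fun n => ((r⁻¹ : ℝ) : 𝕜) * a n)‖ ^ (2 * k) =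
      (r ^ (2 * k))⁻¹ * ‖signedSum s A a‖ ^ (2 * k) := fun A => by
    have := map_signedSum (AddMonoidHom.mulLeft ((r⁻¹ : ℝ) : 𝕜)) s A a
    simp only [AddMonoidHom.coe_mulLeft] at this
    rw [← this, norm_mul, mul_pow, RCLike.norm_ofReal, abs_of_pos (inv_pos.2 hr), inv_pow]
  simp only [h3, ← Finset.mul_sum] at h2
  rwa [inv_mul_le_iff₀ (by positivity), mul_comm (r ^ (2 * k))] at h2

/-- The first moment is controlled from below by the second and the fourth: u² ≤ (mr)u + u⁴/(mr)²,
by comparing u with mr. Since m² is twice the fourth-moment constant, the last term averages to at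
most r²/2, half of the second moment r², and is absorbed. -/
lemma le_sum_norm_signedSum (s : Finset ι) (a : ι → 𝕜) {r : ℝ} (hr : 0 < r)
    (ha : ∑ n ∈ s, ‖a n‖ ^ 2 = r ^ 2) :
    2 ^ s.card * r ≤
      2 * √(2 * khintchineConst 2) * ∑ A ∈ s.powerset, ‖signedSum s A a‖ := by
  have hK := khintchineConst_pos 2
  set m := √(2 * khintchineConst 2) with hm
  have hm0 : 0 < m := Real.sqrt_pos.2 (by positivity)
  have hm2 : m ^ 2 = 2 * khintchineConst 2 := Real.sq_sqrt (by positivity)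
  have key : ∀ u : ℝ, 0 ≤ u → u ^ 2 ≤ (m * r) * u + u ^ (2 * 2) / (m * r) ^ 2 := fun u hu => by
    have hM : 0 < m * r := by positivity
    rcases le_total u (m * r) with h | h
    · have : 0 ≤ u ^ (2 * 2) / (m * r) ^ 2 := by positivity
      nlinarith
    · have : u ^ 2 ≤ u ^ (2 * 2) / (m * r) ^ 2 := by
        rw [le_div_iff₀ (by positivity), pow_mul, sq (u ^ 2)]
        gcongr
      have : 0 ≤ m * r * u := by positivity
      linarith
  have h := Finset.sum_le_sum fun A (_ : A ∈ s.powerset) => key ‖signedSum s A a‖ (norm_nonneg _)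
  rw [sum_norm_sq_signedSum, ha, Finset.sum_add_distrib, ← Finset.mul_sum, ← Finset.sum_div] at h
  have h4 : (∑ A ∈ s.powerset, ‖signedSum s A a‖ ^ (2 * 2)) / (m * r) ^ 2 ≤
      2 ^ s.card * r ^ 2 / 2 := by
    rw [div_le_iff₀ (by positivity), mul_pow, hm2]
    refine (sum_norm_pow_signedSum_le s a hr ha).trans_eq ?_
    ring
  have h5 : r * (2 ^ s.card * r) ≤ r * (2 * m * ∑ A ∈ s.powerset, ‖signedSum s A a‖) := by
    nlinarith
  exact le_of_mul_le_mul_left h5 hr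

lemma sum_norm_signedSum_le (s : Finset ι) (a : ι → 𝕜) {r : ℝ} (hr : 0 ≤ r)
    (ha : ∑ n ∈ s, ‖a n‖ ^ 2 = r ^ 2) :
    ∑ A ∈ s.powerset, ‖signedSum s A a‖ ≤ 2 ^ s.card * r := by
  refine (sq_le_sq₀ (by positivity) (by positivity)).1 ?_
  have := sq_sum_le_card_mul_sum_sq (s := s.powerset) (f := fun A => ‖signedSum s A a‖)
  rw [sum_norm_sq_signedSum, ha, Finset.card_powerset] at this
  push_cast at this
  linarith

end Khintchine

/-! ### Truncation, and Khintchine's inequality in `ℝ≥0∞` -/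

/-- The function `min u (u ^ m)`. -/
noncomputable def minPow (m : ℕ) (u : ℝ≥0∞) : ℝ≥0∞ := min u (u ^ m)

lemma minPow_mono (m : ℕ) : Monotone (minPow m) :=
  fun _ _ h => min_le_min h (pow_le_pow_left' h m)

lemma measurable_minPow (m : ℕ) : Measurable (minPow m) :=
  measurable_id.min (measurable_id.pow_const m)

lemma minPow_mul_le {m : ℕ} (hm : m ≠ 0) {a : ℝ≥0∞} (ha : 1 ≤ a) (u : ℝ≥0∞) :
    minPow m (a * u) ≤ a ^ m * minPow m u := by
  have : a ≤ a ^ m := le_self_pow₀ ha hm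
  rw [minPow, minPow, mul_min, mul_pow]
  gcongr

/-- The left side vanishes for u ≤ l, and for u ≥ l the minimum is u / l. Truncation is thus
controlled by the first and the m-th power at once. -/
lemma tsub_le_mul_minPow {m : ℕ} (hm : m ≠ 0) {l : ℝ≥0∞} (hl : l ≠ 0) (hl' : l ≠ ∞)
    (u : ℝ≥0∞) : u - l ≤ l * minPow m (u / l) := by
  rcases le_total u l with h | h
  · simp [tsub_eq_zero_of_le h]
  · have h1 : 1 ≤ u / l := by rwa [ENNReal.le_div_iff_mul_le (.inl hl) (.inl hl'), one_mul]
    rw [minPow, min_eq_left (le_self_pow₀ h1 hm), ENNReal.mul_div_cancel hl hl']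
    exact tsub_le_self

section Khintchine

variable {ι 𝕜 : Type*} [RCLike 𝕜] (s : Finset ι) (a : ι → 𝕜)

/-- The square function of the family `a` over `s`. -/
noncomputable def squareFun : ℝ := √(∑ n ∈ s, ‖a n‖ ^ 2)

lemma squareFun_nonneg : 0 ≤ squareFun s a := Real.sqrt_nonneg _

lemma sum_norm_sq_eq_squareFun_sq : ∑ n ∈ s, ‖a n‖ ^ 2 = squareFun s a ^ 2 :=
  (Real.sq_sqrt (by positivity)).symm

lemma squareFun_eq_zero {s : Finset ι} {a : ι → 𝕜} (h : squareFun s a = 0) :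
    ∀ n ∈ s, a n = 0 := by
  have h1 := sum_norm_sq_eq_squareFun_sq s a
  rw [h, zero_pow two_ne_zero, Finset.sum_eq_zero_iff_of_nonneg fun _ _ => by positivity] at h1
  intro n hn
  simpa using h1 n hn

variable [DecidableEq ι]

lemma sum_enorm_signedSum_le :
    ∑ A ∈ s.powerset, ‖signedSum s A a‖ₑ ≤ 2 ^ s.card * ‖squareFun s a‖ₑ := by
  have h := ENNReal.ofReal_le_ofReal
    (sum_norm_signedSum_le s a (squareFun_nonneg s a) (sum_norm_sq_eq_squareFun_sq s a))
  rw [ENNReal.ofReal_sum_of_nonneg fun _ _ => norm_nonneg _, ENNReal.ofReal_mul (by positivity),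
    ENNReal.ofReal_pow (by norm_num), ENNReal.ofReal_ofNat,
    ← Real.enorm_eq_ofReal (squareFun_nonneg s a)] at h
  simpa only [ofReal_norm] using h

lemma sum_enorm_pow_signedSum_le {k : ℕ} (hk : k ≠ 0) :
    ∑ A ∈ s.powerset, ‖signedSum s A a‖ₑ ^ (2 * k) ≤
      2 ^ s.card * (ENNReal.ofReal (khintchineConst k) * ‖squareFun s a‖ₑ ^ (2 * k)) := by
  rcases (squareFun_nonneg s a).eq_or_lt with h0 | h0
  · have : ∀ A, signedSum s A a = 0 := fun A => Finset.sum_eq_zero fun n hn => by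
      simp [squareFun_eq_zero h0.symm n hn]
    simp [this, hk]
  have h := ENNReal.ofReal_le_ofReal
    (sum_norm_pow_signedSum_le (k := k) s a h0 (sum_norm_sq_eq_squareFun_sq s a))
  have hK := khintchineConst_pos k
  rw [ENNReal.ofReal_sum_of_nonneg fun _ _ => by positivity, ENNReal.ofReal_mul (by positivity),
    ENNReal.ofReal_mul (by positivity), ENNReal.ofReal_pow (by norm_num), ENNReal.ofReal_ofNat,
    ENNReal.ofReal_pow h0.le, ← Real.enorm_eq_ofReal h0.le, mul_assoc] at h
  simpa only [ENNReal.ofReal_pow (norm_nonneg _), ofReal_norm] using h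

lemma enorm_squareFun_le :
    2 ^ s.card * ‖squareFun s a‖ₑ ≤ ENNReal.ofReal (2 * √(2 * khintchineConst 2)) *
      ∑ A ∈ s.powerset, ‖signedSum s A a‖ₑ := by
  rcases (squareFun_nonneg s a).eq_or_lt with h0 | h0
  · simp [← h0]
  have h := ENNReal.ofReal_le_ofReal
    (le_sum_norm_signedSum s a h0 (sum_norm_sq_eq_squareFun_sq s a))
  rw [ENNReal.ofReal_mul (by positivity), ENNReal.ofReal_mul (p := 2 * √_) (by positivity),
    ENNReal.ofReal_pow (by norm_num), ENNReal.ofReal_ofNat,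
    ENNReal.ofReal_sum_of_nonneg fun _ _ => norm_nonneg _,
    ← Real.enorm_eq_ofReal (squareFun_nonneg s a)] at h
  simpa only [ofReal_norm] using h

lemma one_le_khintchineConst (k : ℕ) : 1 ≤ khintchineConst k := by
  have h1 : (1 : ℝ) ≤ 2 ^ k := one_le_pow₀ (by norm_num)
  have h2 : (1 : ℝ) ≤ (2 * k).factorial := by exact_mod_cast Nat.factorial_pos _
  have h3 : (1 : ℝ) ≤ Real.exp (1 / 2) := Real.one_le_exp (by norm_num)
  exact one_le_mul_of_one_le_of_one_le h1
    (one_le_mul_of_one_le_of_one_le (by linarith) h3)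

/-- The truncated average is bounded by the first moment and by the moment of order 2k. The square
function does not depend on the signs, so the minimum of the two bounds can be taken after
averaging. -/
lemma sum_enorm_signedSum_tsub_le {k : ℕ} (hk : k ≠ 0) {l : ℝ≥0∞} (hl : l ≠ 0) (hl' : l ≠ ∞) :
    ∑ A ∈ s.powerset, (‖signedSum s A a‖ₑ - l) ≤ 2 ^ s.card *
      (ENNReal.ofReal (khintchineConst k) * (l * minPow (2 * k) (‖squareFun s a‖ₑ / l))) := by
  have hK : 1 ≤ ENNReal.ofReal (khintchineConst k) := by
    simpa using ENNReal.ofReal_le_ofReal (one_le_khintchineConst k)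
  rw [minPow, mul_min, mul_min, mul_min, ENNReal.mul_div_cancel hl hl']
  refine le_min ?_ ?_
  · refine (Finset.sum_le_sum fun A _ => tsub_le_self).trans
      ((sum_enorm_signedSum_le s a).trans ?_)
    gcongr
    exact le_mul_of_one_le_left' hK
  · calc _ ≤ ∑ A ∈ s.powerset, l * (l⁻¹ ^ (2 * k) * ‖signedSum s A a‖ₑ ^ (2 * k)) :=
          Finset.sum_le_sum fun A _ => by
            refine (tsub_le_mul_minPow (m := 2 * k) (by omega) hl hl' _).trans ?_
            gcongr
            rw [minPow, ← mul_pow, ← ENNReal.div_eq_inv_mul]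
            exact min_le_right _ _
      _ ≤ l * (l⁻¹ ^ (2 * k) * (2 ^ s.card *
          (ENNReal.ofReal (khintchineConst k) * ‖squareFun s a‖ₑ ^ (2 * k)))) := by
          rw [← Finset.mul_sum, ← Finset.mul_sum]
          gcongr
          exact sum_enorm_pow_signedSum_le s a hk
      _ = _ := by rw [div_eq_mul_inv, mul_pow]; ring

end Khintchine

/-! ### Distributional comparison of the sum and the square function -/

section WeakType

variable {Ω : Type*} [MeasurableSpace Ω] {μ : Measure Ω}

/-- Markov's inequality for the excess over b, which is at least c where ‖f‖ > b + c. -/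
lemma mul_distFun_add_le {E : Type*} [NormedAddCommGroup E] {f : Ω → E}
    (hf : AEMeasurable (fun ω => ‖f ω‖ₑ) μ) (b c : ℝ≥0) :
    c * distFun f μ (b + c) ≤ ∫⁻ ω, (‖f ω‖ₑ - b) ∂μ := by
  refine le_trans ?_ (mul_meas_ge_le_lintegral₀ (hf.sub_const _) (c : ℝ≥0∞))
  refine mul_le_mul_right (measure_mono fun ω hω => ?_) _
  have h1 : ((b + c : ℝ≥0) : ℝ) < ‖f ω‖ := hω
  have h2 : b + c ≤ ‖f ω‖₊ := by exact_mod_cast h1.le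
  have h3 : (b : ℝ≥0∞) + c ≤ ‖f ω‖ₑ := by rw [enorm_eq_nnnorm]; exact_mod_cast h2
  exact ENNReal.le_sub_of_add_le_left (by simp) h3

variable {𝕜 : Type*} [RCLike 𝕜] {ι : Type*} [Fintype ι] {X : ι → Ω → 𝕜}

lemma aemeasurable_squareFun (hX : ∀ n, AEMeasurable (X n) μ) :
    AEMeasurable (fun ω => squareFun Finset.univ (X · ω)) μ := by
  unfold squareFun
  fun_prop

variable [DecidableEq ι]

lemma aemeasurable_signedSum (hX : ∀ n, AEMeasurable (X n) μ) (A : Finset ι) :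
    AEMeasurable (fun ω => signedSum Finset.univ A (X · ω)) μ := by
  unfold signedSum
  refine Finset.aemeasurable_fun_sum _ fun n _ => ?_
  by_cases hn : n ∈ A <;> simp only [hn, if_true, if_false]
  exacts [hX n, (hX n).neg]

variable [IsProbabilityMeasure μ]

lemma distFun_sum_le (h : iIndepFun X μ) (hint : ∀ n, Integrable (X n) μ)
    (h0 : ∀ n, ∫ ω, X n ω ∂μ = 0) {k : ℕ} (hk : k ≠ 0) {l : ℝ≥0} (hl : l ≠ 0) :
    distFun (fun ω => ∑ n, X n ω) μ (3 * l) ≤ 2 * ENNReal.ofReal (khintchineConst k) *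
      ∫⁻ ω, minPow (2 * k) (‖squareFun Finset.univ (X · ω)‖ₑ / l) ∂μ := by
  have hX := fun n => (hint n).aestronglyMeasurable.aemeasurable
  have hQ := aemeasurable_squareFun hX
  have hT := aemeasurable_signedSum hX
  have hl0 : (l : ℝ≥0∞) ≠ 0 := by exact_mod_cast hl
  set D := distFun (fun ω => ∑ n, X n ω) μ (3 * l)
  have h1 : ∀ A : Finset ι, l * D ≤
      2 * ∫⁻ ω, (‖signedSum Finset.univ A (X · ω)‖ₑ - l) ∂μ := fun A => by
    refine le_trans ?_ (lintegral_enorm_sum_tsub_le h hint h0 A l)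
    -- The level 3l is 2l for undoing the sign change plus l for Markov's inequality.
    have := mul_distFun_add_le (f := fun ω => ∑ n, X n ω) (μ := μ) (by fun_prop) (2 * l) l
    rw [show 2 * l + l = 3 * l by ring] at this
    simpa using this
  have h2 := Finset.sum_le_sum fun A (_ : A ∈ (Finset.univ : Finset ι).powerset) => h1 A
  rw [Finset.sum_const, Finset.card_powerset, nsmul_eq_mul, ← Finset.mul_sum,
    ← lintegral_finsetSum' _ fun A _ => ((hT A).enorm.sub_const _)] at h2
  have h3 := h2.trans (mul_le_mul_right (lintegral_mono fun ω =>
    sum_enorm_signedSum_tsub_le Finset.univ (X · ω) hk hl0 (by simp)) 2)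
  have hm : AEMeasurable
      (fun ω => minPow (2 * k) (‖squareFun Finset.univ (X · ω)‖ₑ / l)) μ :=
    (measurable_minPow _).comp_aemeasurable (hQ.enorm.div_const _)
  rw [lintegral_const_mul'' _ ((hm.const_mul _).const_mul _),
    lintegral_const_mul'' _ (hm.const_mul _), lintegral_const_mul'' _ hm] at h3
  push_cast at h3
  refine (ENNReal.mul_le_mul_iff_right (a := 2 ^ (Finset.univ : Finset ι).card * l)
    (by simp [hl]) (ENNReal.mul_ne_top (by simp) (by simp))).1 ?_
  refine (mul_assoc _ _ _).trans_le (h3.trans_eq ?_)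
  ring

lemma distFun_squareFun_le (h : iIndepFun X μ) (hint : ∀ n, Integrable (X n) μ)
    (h0 : ∀ n, ∫ ω, X n ω ∂μ = 0) {k : ℕ} (hk : k ≠ 0) {l : ℝ≥0} (hl : l ≠ 0) :
    distFun (fun ω => squareFun Finset.univ (X · ω)) μ
        (3 * (2 * √(2 * khintchineConst 2)).toNNReal * l) ≤
      2 * ∫⁻ ω, minPow (2 * k) (‖∑ n, X n ω‖ₑ / l) ∂μ := by
  have hX := fun n => (hint n).aestronglyMeasurable.aemeasurable
  have hQ := aemeasurable_squareFun hX
  have hT := aemeasurable_signedSum hX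
  have hl0 : (l : ℝ≥0∞) ≠ 0 := by exact_mod_cast hl
  set M : ℝ≥0 := (2 * √(2 * khintchineConst 2)).toNNReal with hM
  have hM0 : M ≠ 0 := by
    have := khintchineConst_pos 2
    exact (Real.toNNReal_pos.2 (by positivity)).ne'
  have hMtop : (M : ℝ≥0∞) ≠ ∞ := by simp
  set D := distFun (fun ω => squareFun Finset.univ (X · ω)) μ (3 * M * l) with hD
  set c := (Finset.univ : Finset ι).card
  have h1 : M * l * D ≤ ∫⁻ ω, (‖squareFun Finset.univ (X · ω)‖ₑ - M * (2 * l)) ∂μ := by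
    have := mul_distFun_add_le hQ.enorm (2 * M * l) (M * l)
    rw [show 2 * M * l + M * l = 3 * M * l by ring] at this
    simpa [hD, mul_left_comm, mul_assoc] using this
  have h2 : 2 ^ c * ∫⁻ ω, (‖squareFun Finset.univ (X · ω)‖ₑ - M * (2 * l)) ∂μ ≤
      M * ∑ A ∈ (Finset.univ : Finset ι).powerset,
        ∫⁻ ω, (‖signedSum Finset.univ A (X · ω)‖ₑ - 2 * l) ∂μ := by
    rw [← lintegral_finsetSum' _ fun A _ => ((hT A).enorm.sub_const _),
      ← lintegral_const_mul'' _ (hQ.enorm.sub_const _),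
      ← lintegral_const_mul'' _ (Finset.aemeasurable_fun_sum _ fun A _ =>
        ((hT A).enorm.sub_const _))]
    refine lintegral_mono fun ω => ?_
    -- Pointwise lower Khintchine inequality: the subtracted term 2^c · M · 2l is spread equally
    -- over the 2^c sign choices, leaving ‖T‖ ≤ (‖T‖ - 2l)₊ + 2l for each signed sum T.
    rw [ENNReal.mul_sub fun _ _ => by simp, tsub_le_iff_right]
    refine (enorm_squareFun_le _ _).trans ?_
    have : 2 ^ c * (M * (2 * (l : ℝ≥0∞))) =
        M * ∑ A ∈ (Finset.univ : Finset ι).powerset, 2 * (l : ℝ≥0∞) := by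
      rw [Finset.sum_const, Finset.card_powerset, nsmul_eq_mul]
      push_cast
      ring
    rw [this, ← mul_add, ← Finset.sum_add_distrib]
    exact mul_le_mul_right (Finset.sum_le_sum fun A _ => le_tsub_add) _
  have hm : AEMeasurable (fun ω => minPow (2 * k) (‖∑ n, X n ω‖ₑ / l)) μ :=
    (measurable_minPow _).comp_aemeasurable
      ((Finset.aemeasurable_fun_sum _ fun n _ => hX n).enorm.div_const _)
  have h3 : ∑ A ∈ (Finset.univ : Finset ι).powerset,
      ∫⁻ ω, (‖signedSum Finset.univ A (X · ω)‖ₑ - 2 * l) ∂μ ≤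
      2 ^ c * (2 * (l * ∫⁻ ω, minPow (2 * k) (‖∑ n, X n ω‖ₑ / l) ∂μ)) := by
    refine (Finset.sum_le_sum fun A _ =>
      (lintegral_enorm_signedSum_tsub_le h hint h0 A l).trans (mul_le_mul_right
        (lintegral_mono fun ω => tsub_le_mul_minPow (m := 2 * k) (by omega) hl0 (by simp) _)
        2)).trans_eq ?_
    rw [Finset.sum_const, Finset.card_powerset, nsmul_eq_mul, lintegral_const_mul'' _ hm]
    push_cast
    rfl
  refine (ENNReal.mul_le_mul_iff_right (a := 2 ^ c * (M * l))
    (by simp [hl, hM0]) (ENNReal.mul_ne_top (by simp) (ENNReal.mul_ne_top hMtop (by simp)))).1 ?_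
  calc _ = 2 ^ c * (M * l * D) := mul_assoc _ _ _
    _ ≤ _ := (mul_le_mul_right h1 _).trans (h2.trans (mul_le_mul_right h3 _))
    _ = _ := by ring

end WeakType

/-! ### Lorentz norms through the distribution function -/

section Rearrangement

variable {Ω E : Type*} [MeasurableSpace Ω] [NormedAddCommGroup E] (f : Ω → E) (μ : Measure Ω)

lemma distFun_antitone : Antitone (distFun f μ) := fun a b hab =>
  measure_mono fun ω (hω : (b : ℝ) < ‖f ω‖) => lt_of_le_of_lt (by exact_mod_cast hab) hω

lemma rearrangement_antitone : Antitone (rearrangement f μ) := fun _ _ h =>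
  le_iInf₂ fun l hl => iInf₂_le l ⟨hl.1, hl.2.trans (ENNReal.ofReal_le_ofReal h)⟩

/-- Right continuity of the distribution function. The superlevel sets increase to the limit set, so
continuity from below suffices and the measure need not be finite. -/
lemma exists_lt_distFun_of_lt {c : ℝ≥0∞} {l : ℝ≥0} (h : c < distFun f μ l) :
    ∃ l', l < l' ∧ c < distFun f μ l' := by
  have hU : {ω | (l : ℝ) < ‖f ω‖} = ⋃ n : ℕ, {ω | ((l + 1 / (n + 1) : ℝ≥0) : ℝ) < ‖f ω‖} := by
    ext ω
    simp only [Set.mem_ofPred_eq, Set.mem_iUnion]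
    constructor
    · intro hω
      obtain ⟨n, hn⟩ := exists_nat_one_div_lt (sub_pos.2 hω)
      refine ⟨n, ?_⟩
      push_cast
      linarith
    · rintro ⟨n, hn⟩
      refine lt_of_le_of_lt ?_ hn
      push_cast
      have : (0 : ℝ) ≤ 1 / (n + 1) := by positivity
      linarith
  have hm : Monotone fun n : ℕ => {ω | ((l + 1 / (n + 1) : ℝ≥0) : ℝ) < ‖f ω‖} :=
    fun a b hab => by
      intro ω hω
      change ((l + 1 / (a + 1) : ℝ≥0) : ℝ) < ‖f ω‖ at hω
      change ((l + 1 / (b + 1) : ℝ≥0) : ℝ) < ‖f ω‖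
      refine lt_of_le_of_lt ?_ hω
      push_cast
      gcongr
  rw [distFun, hU, hm.measure_iUnion, lt_iSup_iff] at h
  obtain ⟨n, hn⟩ := h
  exact ⟨l + 1 / (n + 1), lt_add_of_pos_right _ (by positivity), hn⟩

/-- The rearrangement is the generalized inverse of the distribution function. Right continuity
makes the equivalence exact with strict inequalities; the restriction to positive levels in the
infimum is handled by an arbitrarily small ε. -/
lemma lt_rearrangement_iff (l : ℝ≥0) (t : ℝ) :
    (l : ℝ≥0∞) < rearrangement f μ t ↔ ENNReal.ofReal t < distFun f μ l := by
  constructor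
  · intro h
    by_contra! hd
    refine h.not_ge (ENNReal.le_of_forall_pos_le_add fun ε hε _ => ?_)
    have : rearrangement f μ t ≤ (l + ε : ℝ≥0) := iInf₂_le (l + ε)
      ⟨lt_of_lt_of_le hε le_add_self, (distFun_antitone f μ le_self_add).trans hd⟩
    exact_mod_cast this
  · intro h
    obtain ⟨l', hl', h'⟩ := exists_lt_distFun_of_lt f μ h
    refine lt_of_lt_of_le (ENNReal.coe_lt_coe.2 hl') (le_iInf₂ fun x hx => ?_)
    by_contra! hlt
    exact (h'.trans_le ((distFun_antitone f μ (ENNReal.coe_lt_coe.1 hlt).le).trans hx.2)).false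

/-- Test the supremum at each t = c below d_f(l), where f^*(c) > l. With `lorentzNorm_top_le` this
identifies L^{p,∞} as weak L^p, with equal constants. -/
lemma distFun_le_of_lorentzNorm_top {p : ℝ} (hp : 0 < p) {l : ℝ≥0} (hl : l ≠ 0) :
    distFun f μ l ≤ (lorentzNorm f p ∞ μ / l) ^ p := by
  refine le_of_forall_lt_imp_le_of_dense fun c hc => ?_
  rcases eq_or_ne c 0 with rfl | hc0
  · exact zero_le
  have hct : c ≠ ∞ := hc.ne_top
  have ht : 0 < c.toReal := ENNReal.toReal_pos hc0 hct
  have h1 : (l : ℝ≥0∞) < rearrangement f μ c.toReal :=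
    (lt_rearrangement_iff f μ l _).2 (by rwa [ENNReal.ofReal_toReal hct])
  have h2 : c ^ (1 / p) * l ≤ lorentzNorm f p ∞ μ := by
    rw [lorentzNorm, if_pos rfl]
    refine le_trans ?_ (le_iSup₂ c.toReal ht)
    rw [← ENNReal.ofReal_rpow_of_pos ht, ENNReal.ofReal_toReal hct]
    gcongr
  rw [← ENNReal.le_div_iff_mul_le (.inl (by simpa using hl)) (.inl (by simp)), one_div] at h2
  exact (ENNReal.rpow_inv_le_iff hp).1 h2

lemma lorentzNorm_top_le {p : ℝ} (hp : 0 < p) {B : ℝ≥0∞}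
    (h : ∀ l : ℝ≥0, l ≠ 0 → distFun f μ l ≤ (B / l) ^ p) : lorentzNorm f p ∞ μ ≤ B := by
  rw [lorentzNorm, if_pos rfl]
  refine iSup₂_le fun t ht => ?_
  have ht0 : ENNReal.ofReal (t ^ (1 / p)) ≠ 0 := by
    simpa using Real.rpow_pos_of_pos ht _
  rw [mul_comm, ← ENNReal.le_div_iff_mul_le (.inl ht0) (.inl (by simp))]
  refine le_of_forall_lt_imp_le_of_dense fun c hc => ?_
  lift c to ℝ≥0 using hc.ne_top
  rcases eq_or_ne c 0 with rfl | hc0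
  · simp
  have h1 := ((lt_rearrangement_iff f μ c t).1 hc).trans_le (h c hc0)
  rw [ENNReal.le_div_iff_mul_le (.inl ht0) (.inl (by simp)), mul_comm,
    ← ENNReal.le_div_iff_mul_le (.inl (by simpa using hc0)) (.inl (by simp)),
    ← ENNReal.ofReal_rpow_of_pos ht, one_div]
  exact (ENNReal.rpow_inv_le_iff hp).2 h1.le

lemma setLIntegral_rpow_indicator_lt {a : ℝ} (ha : 0 < a) (x : ℝ≥0∞) :
    ∫⁻ l in Set.Ioi (0 : ℝ), {l : ℝ | ENNReal.ofReal l < x}.indicator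
      (fun l => ENNReal.ofReal (l ^ (a - 1))) l = x ^ a / ENNReal.ofReal a := by
  have hfin : ∀ r : ℝ≥0, ∫⁻ l in Set.Ioi (0 : ℝ), {l : ℝ | ENNReal.ofReal l < r}.indicator
      (fun l => ENNReal.ofReal (l ^ (a - 1))) l = (r : ℝ≥0∞) ^ a / ENNReal.ofReal a := fun r => by
    have hset : Set.Ioi (0 : ℝ) ∩ {l : ℝ | ENNReal.ofReal l < r} = Set.Ioo 0 (r : ℝ) := by
      ext l
      simp only [Set.mem_inter_iff, Set.mem_Ioi, Set.mem_ofPred_eq, Set.mem_Ioo,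
        ← ENNReal.ofReal_coe_nnreal]
      refine and_congr_right fun hl => ?_
      rw [ENNReal.ofReal_lt_ofReal_iff_of_nonneg hl.le]
    have hms : MeasurableSet {l : ℝ | ENNReal.ofReal l < r} :=
      measurableSet_lt (by fun_prop) measurable_const
    have hI : IntervalIntegrable (fun l : ℝ => l ^ (a - 1)) volume 0 r :=
      intervalIntegral.intervalIntegrable_rpow' (by linarith)
    have h1 := ofReal_integral_eq_lintegral_ofReal
        ((intervalIntegrable_iff_integrableOn_Ioc_of_le r.coe_nonneg).1 hI)
        ((ae_restrict_iff' measurableSet_Ioc).2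
          (Filter.Eventually.of_forall fun l hl => Real.rpow_nonneg hl.1.le _))
    rw [setLIntegral_indicator hms, Set.inter_comm, hset, setLIntegral_congr Ioo_ae_eq_Ioc]
    refine h1.symm.trans ?_
    rw [← intervalIntegral.integral_of_le r.coe_nonneg, integral_rpow (.inl (by linarith)),
      sub_add_cancel, Real.zero_rpow ha.ne', sub_zero, ENNReal.ofReal_div_of_pos ha,
      ← ENNReal.ofReal_rpow_of_nonneg r.coe_nonneg ha.le, ENNReal.ofReal_coe_nnreal]
  induction x with
  | coe r => exact hfin r
  | top =>
    rw [ENNReal.top_rpow_of_pos ha, ENNReal.top_div_of_ne_top (by simp)]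
    refine ENNReal.eq_top_of_forall_nnreal_le fun r => ?_
    -- This upper limit makes the truncated integral equal to r.
    have h1 := hfin ((r * a.toNNReal) ^ a⁻¹)
    rw [ENNReal.coe_rpow_of_nonneg _ (inv_nonneg.2 ha.le), ENNReal.rpow_inv_rpow ha.ne',
      ENNReal.coe_mul] at h1
    change _ = _ * ENNReal.ofReal a / ENNReal.ofReal a at h1
    rw [ENNReal.mul_div_cancel_right (by simpa using ha) (by simp)] at h1
    rw [← h1]
    refine lintegral_mono fun l => Set.indicator_le_indicator_of_subset ?_ (by simp) l
    intro l hl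
    exact ENNReal.ofReal_lt_top

/-- Layer cake twice: write f^*(t)^q as q times the integral of l^(q-1) over l < f^*(t), exchange
the integrals, and replace that condition by t < d_f(l), over which t^(q/p-1) is integrated. -/
lemma lintegral_rearrangement_eq {p q : ℝ} (hp : 0 < p) (hq : 0 < q) :
    ∫⁻ t in Set.Ioi (0 : ℝ),
      (ENNReal.ofReal (t ^ (1 / p)) * rearrangement f μ t) ^ q / ENNReal.ofReal t =
    ENNReal.ofReal q / ENNReal.ofReal (q / p) *
      ∫⁻ l in Set.Ioi (0 : ℝ), ENNReal.ofReal (l ^ (q - 1)) *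
        distFun f μ l.toNNReal ^ (q / p) := by
  have hqp : 0 < q / p := div_pos hq hp
  have hq0 : ENNReal.ofReal q ≠ 0 := by simpa using hq
  have hmr : Measurable (rearrangement f μ) := (rearrangement_antitone f μ).measurable
  have hms : MeasurableSet {z : ℝ × ℝ | ENNReal.ofReal z.2 < rearrangement f μ z.1} :=
    measurableSet_lt (by fun_prop) (by fun_prop)
  have hmd : Measurable fun l : ℝ => distFun f μ l.toNNReal :=
    ((distFun_antitone f μ).comp_monotone fun _ _ => Real.toNNReal_mono).measurable
  calc _ = ∫⁻ t in Set.Ioi (0 : ℝ), ∫⁻ l in Set.Ioi (0 : ℝ), ENNReal.ofReal q *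
        {z : ℝ × ℝ | ENNReal.ofReal z.2 < rearrangement f μ z.1}.indicator (fun z =>
          ENNReal.ofReal (z.1 ^ (q / p - 1)) * ENNReal.ofReal (z.2 ^ (q - 1))) (t, l) := by
        refine setLIntegral_congr_fun measurableSet_Ioi fun t (ht : 0 < t) => ?_
        have h1 : ∀ l, {z : ℝ × ℝ | ENNReal.ofReal z.2 < rearrangement f μ z.1}.indicator
            (fun z => ENNReal.ofReal (z.1 ^ (q / p - 1)) * ENNReal.ofReal (z.2 ^ (q - 1))) (t, l)
            = ENNReal.ofReal (t ^ (q / p - 1)) *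
              {l : ℝ | ENNReal.ofReal l < rearrangement f μ t}.indicator
                (fun l => ENNReal.ofReal (l ^ (q - 1))) l := fun l => by
          simp [Set.indicator_apply]
        simp only [h1]
        rw [lintegral_const_mul _ ((by fun_prop : Measurable _).indicator
              (measurableSet_lt (by fun_prop) measurable_const) |>.const_mul _),
          lintegral_const_mul _ ((by fun_prop : Measurable _).indicator
              (measurableSet_lt (by fun_prop) measurable_const)),
          setLIntegral_rpow_indicator_lt hq, mul_left_comm,
          ENNReal.mul_div_cancel hq0 (by simp),
          ENNReal.mul_rpow_of_nonneg _ _ hq.le, Real.rpow_sub_one ht.ne',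
          ENNReal.ofReal_div_of_pos ht, ENNReal.ofReal_rpow_of_nonneg (by positivity) hq.le,
          ← Real.rpow_mul ht.le, div_mul_eq_mul_div, one_mul]
        simp only [div_eq_mul_inv]
        ring
    _ = ∫⁻ l in Set.Ioi (0 : ℝ), ∫⁻ t in Set.Ioi (0 : ℝ), ENNReal.ofReal q *
        {z : ℝ × ℝ | ENNReal.ofReal z.2 < rearrangement f μ z.1}.indicator (fun z =>
          ENNReal.ofReal (z.1 ^ (q / p - 1)) * ENNReal.ofReal (z.2 ^ (q - 1))) (t, l) :=
        lintegral_lintegral_swap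
          (((by fun_prop : Measurable _).indicator hms).const_mul _).aemeasurable
    _ = ∫⁻ l in Set.Ioi (0 : ℝ), ENNReal.ofReal q / ENNReal.ofReal (q / p) *
        (ENNReal.ofReal (l ^ (q - 1)) * distFun f μ l.toNNReal ^ (q / p)) := by
        refine setLIntegral_congr_fun measurableSet_Ioi fun l (hl : 0 < l) => ?_
        have h1 : ∀ t, {z : ℝ × ℝ | ENNReal.ofReal z.2 < rearrangement f μ z.1}.indicator
            (fun z => ENNReal.ofReal (z.1 ^ (q / p - 1)) * ENNReal.ofReal (z.2 ^ (q - 1))) (t, l)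
            = ENNReal.ofReal (l ^ (q - 1)) *
              {t : ℝ | ENNReal.ofReal t < distFun f μ l.toNNReal}.indicator
                (fun t => ENNReal.ofReal (t ^ (q / p - 1))) t := fun t => by
          have := lt_rearrangement_iff f μ l.toNNReal t
          change ENNReal.ofReal l < _ ↔ _ at this
          simp only [Set.indicator_apply, Set.mem_ofPred_eq, this, mul_ite, mul_zero]
          rw [mul_comm]
        simp only [h1]
        rw [lintegral_const_mul _ ((by fun_prop : Measurable _).indicator
              (measurableSet_lt (by fun_prop) measurable_const) |>.const_mul _),
          lintegral_const_mul _ ((by fun_prop : Measurable _).indicator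
              (measurableSet_lt (by fun_prop) measurable_const)),
          setLIntegral_rpow_indicator_lt hqp]
        simp only [div_eq_mul_inv]
        ring
    _ = _ := lintegral_const_mul _ (by fun_prop)

end Rearrangement

/-! ### Dilations and dyadic decomposition -/

lemma setLIntegral_rpow_comp_mul {q c : ℝ} (hc : 0 < c) (h : ℝ → ℝ≥0∞) :
    ENNReal.ofReal (c ^ q) *
      ∫⁻ l in Set.Ioi (0 : ℝ), ENNReal.ofReal (l ^ (q - 1)) * h (c * l) =
    ∫⁻ l in Set.Ioi (0 : ℝ), ENNReal.ofReal (l ^ (q - 1)) * h l := by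
  have himg : (fun l => c * l) '' Set.Ioi (0 : ℝ) = Set.Ioi 0 := by
    rw [Set.image_mul_left_Ioi hc, mul_zero]
  conv_rhs => rw [← himg]
  rw [lintegral_image_eq_lintegral_abs_deriv_mul (f := fun l => c * l) (f' := fun _ => c * 1)
    measurableSet_Ioi (fun x _ => ((hasDerivAt_id x).const_mul c).hasDerivWithinAt)
    (fun x _ y _ hxy => mul_left_cancel₀ hc.ne' hxy), ← lintegral_const_mul' _ _ (by simp)]
  refine setLIntegral_congr_fun measurableSet_Ioi fun l (hl : 0 < l) => ?_
  have h1 : c * c ^ (q - 1) = c ^ q := by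
    rw [Real.rpow_sub_one hc.ne', mul_div_cancel₀ _ hc.ne']
  simp only [mul_one]
  rw [← mul_assoc, ← mul_assoc, abs_of_pos hc, ← ENNReal.ofReal_mul (by positivity),
    ← ENNReal.ofReal_mul hc.le, Real.mul_rpow hc.le hl.le, ← mul_assoc, h1]

lemma coe_two_zpow (k : ℤ) : (((2 : ℝ≥0) ^ k : ℝ≥0) : ℝ≥0∞) = (2 : ℝ≥0∞) ^ (k : ℝ) := by
  rw [ENNReal.rpow_intCast, ENNReal.coe_zpow two_ne_zero]
  rfl

section Dyadic

variable {Ω E : Type*} [MeasurableSpace Ω] [NormedAddCommGroup E] {g : Ω → E} {μ : Measure Ω}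

/-- At each point only the shell 2^k < ‖g‖/l ≤ 2^(k+1) is needed: monotonicity bounds the integrand
by its value at 2^(k+1), and the shell lies in a superlevel set of g. -/
lemma lintegral_minPow_le_tsum (hg : AEMeasurable (fun ω => ‖g ω‖ₑ) μ) {m : ℕ}
    {l : ℝ≥0} (hl : l ≠ 0) :
    ∫⁻ ω, minPow m (‖g ω‖ₑ / l) ∂μ ≤
      ∑' k : ℤ, minPow m (2 ^ ((k : ℝ) + 1)) * distFun g μ (2 ^ k * l) := by
  have hset : ∀ k : ℤ, {ω | ((2 ^ k * l : ℝ≥0) : ℝ) < ‖g ω‖} =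
      {ω | ((2 ^ k * l : ℝ≥0) : ℝ≥0∞) < ‖g ω‖ₑ} := fun k => by
    ext ω
    simp only [Set.mem_ofPred_eq, enorm_eq_nnnorm, ENNReal.coe_lt_coe, ← NNReal.coe_lt_coe,
      coe_nnnorm]
  have hnull : ∀ k : ℤ, NullMeasurableSet {ω | ((2 ^ k * l : ℝ≥0) : ℝ) < ‖g ω‖} μ := fun k => by
    rw [hset]
    exact nullMeasurableSet_lt aemeasurable_const hg
  calc _ ≤ ∫⁻ ω, ∑' k : ℤ, {ω | ((2 ^ k * l : ℝ≥0) : ℝ) < ‖g ω‖}.indicator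
        (fun _ => minPow m (2 ^ ((k : ℝ) + 1))) ω ∂μ := by
        refine lintegral_mono fun ω => ?_
        -- Zero lies in no dyadic shell, but the integrand vanishes there.
        rcases eq_or_ne (‖g ω‖₊ / l) 0 with h0 | h0
        · have : ‖g ω‖ₑ / l = 0 := by
            rw [enorm_eq_nnnorm, ← ENNReal.coe_div hl, h0, ENNReal.coe_zero]
          simp [this, minPow]
        · obtain ⟨k, hk1, hk2⟩ := NNReal.exists_mem_Ioc_zpow h0 one_lt_two
          refine le_trans ?_ (ENNReal.le_tsum k)
          rw [Set.indicator_of_mem]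
          · refine minPow_mono m ?_
            have : (((2 : ℝ≥0) ^ (k + 1) : ℝ≥0) : ℝ≥0∞) = 2 ^ ((k : ℝ) + 1) := by
              rw [coe_two_zpow]; push_cast; rfl
            rw [← this, enorm_eq_nnnorm, ← ENNReal.coe_div hl]
            exact_mod_cast hk2
          · rw [lt_div_iff₀ (pos_iff_ne_zero.2 hl)] at hk1
            exact NNReal.coe_lt_coe.2 hk1
    _ = _ := by
        rw [lintegral_tsum fun k => (aemeasurable_const.indicator₀ (hnull k))]
        refine tsum_congr fun k => ?_
        rw [lintegral_indicator_const₀ (hnull k)]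
        rfl

end Dyadic

/-- The ratio of the geometric decay in the dyadic form of the weak type estimate. -/
noncomputable def decayRatio (p : ℝ) (m : ℕ) : ℝ≥0∞ := 2 ^ (-(min (p - 1) (m - p) / 2))

lemma decayRatio_lt_one {p : ℝ} {m : ℕ} (hp : 1 < p) (hm : p < m) : decayRatio p m < 1 := by
  refine ENNReal.rpow_lt_one_of_one_lt_of_neg ENNReal.one_lt_two ?_
  have : 0 < min (p - 1) (m - p) := lt_min (by linarith) (by linarith)
  linarith

/-- Relative to 2^{kp}, the linear branch gains 2^{-(p-1)k} for k ≥ 0 and the power branch gains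
2^{-(m-p)|k|} for k < 0. The gain is split into two equal factors, one to sum the series and one to
survive in `rpow_tsum_le`. -/
lemma minPow_two_rpow_le {p : ℝ} {m : ℕ} (hp : 1 < p) (hm : p < m) (k : ℤ) :
    minPow m (2 ^ ((k : ℝ) + 1)) ≤
      2 ^ m * (decayRatio p m ^ k.natAbs * (decayRatio p m ^ k.natAbs *
        (2 ^ (k : ℝ)) ^ p)) := by
  have hm1 : (1 : ℝ) ≤ m := by linarith
  set δ := min (p - 1) (m - p) with hδ
  have hδ1 : δ ≤ p - 1 := min_le_left _ _
  have hδ2 : δ ≤ m - p := min_le_right _ _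
  have habs : ((k.natAbs : ℕ) : ℝ) = |(k : ℝ)| := by
    rw [← Int.cast_abs, ← Int.natCast_natAbs, Int.cast_natCast]
  have hrhs : (2 : ℝ≥0∞) ^ m * (decayRatio p m ^ k.natAbs * (decayRatio p m ^ k.natAbs *
      (2 ^ (k : ℝ)) ^ p)) = 2 ^ ((m : ℝ) - δ * |(k : ℝ)| + p * k) := by
    rw [decayRatio, ← ENNReal.rpow_natCast, ← ENNReal.rpow_natCast, ← ENNReal.rpow_mul,
      ← ENNReal.rpow_mul, habs, ← ENNReal.rpow_add _ _ two_ne_zero ENNReal.ofNat_ne_top,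
      ← ENNReal.rpow_add _ _ two_ne_zero ENNReal.ofNat_ne_top,
      ← ENNReal.rpow_add _ _ two_ne_zero ENNReal.ofNat_ne_top]
    congr 1
    ring
  rw [hrhs, minPow]
  rcases le_or_gt 0 (k : ℝ) with hk | hk
  · refine (min_le_left _ _).trans (ENNReal.rpow_le_rpow_of_exponent_le one_le_two ?_)
    rw [abs_of_nonneg hk]
    nlinarith
  · refine (min_le_right _ _).trans ?_
    rw [← ENNReal.rpow_natCast, ← ENNReal.rpow_mul]
    refine ENNReal.rpow_le_rpow_of_exponent_le one_le_two ?_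
    rw [abs_of_neg hk]
    nlinarith

lemma tsum_pow_natAbs_ne_top {r : ℝ≥0∞} (hr : r < 1) : ∑' k : ℤ, r ^ k.natAbs ≠ ∞ := by
  lift r to ℝ≥0 using hr.ne_top
  have hr' : r < 1 := by exact_mod_cast hr
  have h : Summable fun k : ℤ => r ^ k.natAbs := by
    rw [← NNReal.summable_coe, summable_int_iff_summable_nat_and_neg]
    simpa using summable_geometric_of_lt_one r.coe_nonneg (by exact_mod_cast hr')
  simpa using ENNReal.tsum_coe_ne_top_iff_summable.2 h

/-- One weight is spent on bounding the sum by a supremum; the power of the supremum is then at most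
the sum of the powers. This treats θ < 1 and θ ≥ 1 alike. -/
lemma rpow_tsum_le {α : Type*} {θ : ℝ} (hθ : 0 < θ) (v b : α → ℝ≥0∞) :
    (∑' k, v k * (v k * b k)) ^ θ ≤ (∑' k, v k) ^ θ * ∑' k, v k ^ θ * b k ^ θ := by
  have h1 : ∑' k, v k * (v k * b k) ≤ (∑' k, v k) * ⨆ k, v k * b k := by
    rw [← ENNReal.tsum_mul_right]
    exact ENNReal.tsum_le_tsum fun k => mul_le_mul_right (le_iSup (fun k => v k * b k) k) _
  refine (ENNReal.rpow_le_rpow h1 hθ.le).trans ?_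
  rw [ENNReal.mul_rpow_of_nonneg _ _ hθ.le]
  gcongr
  rw [← ENNReal.le_rpow_inv_iff hθ]
  refine iSup_le fun k => ?_
  rw [ENNReal.le_rpow_inv_iff hθ, ENNReal.mul_rpow_of_nonneg _ _ hθ.le]
  exact ENNReal.le_tsum (f := fun k => v k ^ θ * b k ^ θ) k

/-! ### Interpolation from the distributional bound to Lorentz norms -/

section WeakTypeToLorentz

variable {Ω E F : Type*} [MeasurableSpace Ω] [NormedAddCommGroup E] [NormedAddCommGroup F]
  {f : Ω → E} {g : Ω → F} {μ : Measure Ω}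

/-- Apply the hypothesis at l / a; the dilation by a leaves the integrand at the cost of a^m, which
needs a ≥ 1. -/
lemma distFun_le_tsum (hg : AEMeasurable (fun ω => ‖g ω‖ₑ) μ) {p : ℝ} {m : ℕ} (hp : 1 < p)
    (hm : p < m) {C a : ℝ≥0} (ha : 1 ≤ a)
    (h : ∀ l : ℝ≥0, l ≠ 0 → distFun f μ (a * l) ≤ C * ∫⁻ ω, minPow m (‖g ω‖ₑ / l) ∂μ)
    {l : ℝ≥0} (hl : l ≠ 0) :
    distFun f μ l ≤ (C * a ^ m * 2 ^ m : ℝ≥0) * ∑' k : ℤ, decayRatio p m ^ k.natAbs *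
      (decayRatio p m ^ k.natAbs * ((2 ^ (k : ℝ)) ^ p * distFun g μ (2 ^ k * l))) := by
  have ha0 : a ≠ 0 := (zero_lt_one.trans_le ha).ne'
  have hm0 : m ≠ 0 := by rintro rfl; norm_num at hm; linarith
  have h1 := h (l / a) (div_ne_zero hl ha0)
  rw [mul_div_cancel₀ _ ha0] at h1
  have h2 : ∀ ω, minPow m (‖g ω‖ₑ / (l / a : ℝ≥0)) ≤ (a ^ m : ℝ≥0) * minPow m (‖g ω‖ₑ / l) :=
    fun ω => by
      have : ‖g ω‖ₑ / (l / a : ℝ≥0) = a * (‖g ω‖ₑ / l) := by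
        rw [ENNReal.coe_div ha0, div_eq_mul_inv, ENNReal.inv_div (by simp)
          (by simp [ha0]), div_eq_mul_inv, div_eq_mul_inv]
        ring
      rw [this]
      exact_mod_cast minPow_mul_le hm0 (by exact_mod_cast ha) _
  refine h1.trans ?_
  calc _ ≤ (C : ℝ≥0∞) * ((a ^ m : ℝ≥0) * ∫⁻ ω, minPow m (‖g ω‖ₑ / l) ∂μ) := by
        rw [← lintegral_const_mul' (a ^ m : ℝ≥0) _ ENNReal.coe_ne_top]
        exact mul_le_mul_right (lintegral_mono h2) _
    _ ≤ (C : ℝ≥0∞) * ((a ^ m : ℝ≥0) * ∑' k : ℤ, (2 ^ m * (decayRatio p m ^ k.natAbs *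
          (decayRatio p m ^ k.natAbs * (2 ^ (k : ℝ)) ^ p))) * distFun g μ (2 ^ k * l)) := by
        gcongr
        refine (lintegral_minPow_le_tsum hg hl).trans (ENNReal.tsum_le_tsum fun k => ?_)
        gcongr
        exact minPow_two_rpow_le hp hm k
    _ = _ := by
        simp only [mul_assoc, ENNReal.tsum_mul_left]
        push_cast
        ring

/-- The factor by which the Lorentz norm grows in `lorentzNorm_le_of_weakType`. -/
noncomputable def weakTypeConst (p : ℝ) (q : ℝ≥0∞) (m : ℕ) (A : ℝ≥0) : ℝ≥0∞ :=
  if q = ∞ then (A * ∑' k : ℤ, (decayRatio p m * decayRatio p m) ^ k.natAbs) ^ (1 / p)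
  else ((A * ∑' k : ℤ, decayRatio p m ^ k.natAbs) ^ (q.toReal / p) *
    ∑' k : ℤ, (decayRatio p m ^ (q.toReal / p)) ^ k.natAbs) ^ (1 / q.toReal)

lemma weakTypeConst_ne_top {p : ℝ} {q : ℝ≥0∞} {m : ℕ} (hp : 1 < p) (hm : p < m) (hq : q ≠ 0)
    (A : ℝ≥0) : weakTypeConst p q m A ≠ ∞ := by
  have hr := decayRatio_lt_one hp hm
  unfold weakTypeConst
  split_ifs with hq'
  · refine ENNReal.rpow_ne_top_of_nonneg (by positivity) (ENNReal.mul_ne_top (by simp)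
      (tsum_pow_natAbs_ne_top ?_))
    exact (mul_le_of_le_one_right' hr.le).trans_lt hr
  · have hq0 : 0 < q.toReal := ENNReal.toReal_pos hq hq'
    have hθ : 0 < q.toReal / p := by positivity
    exact ENNReal.rpow_ne_top_of_nonneg (by positivity) (ENNReal.mul_ne_top
      (ENNReal.rpow_ne_top_of_nonneg hθ.le (ENNReal.mul_ne_top (by simp)
        (tsum_pow_natAbs_ne_top hr)))
      (tsum_pow_natAbs_ne_top (ENNReal.rpow_lt_one hr hθ)))

lemma lintegral_distFun_dilate {p q : ℝ} (k : ℤ) :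
    ((2 : ℝ≥0∞) ^ (k : ℝ)) ^ q * ∫⁻ l in Set.Ioi (0 : ℝ),
        ENNReal.ofReal (l ^ (q - 1)) * distFun g μ (2 ^ k * l.toNNReal) ^ (q / p) =
      ∫⁻ l in Set.Ioi (0 : ℝ), ENNReal.ofReal (l ^ (q - 1)) *
        distFun g μ l.toNNReal ^ (q / p) := by
  have hc : (0 : ℝ) < (2 : ℝ) ^ (k : ℝ) := by positivity
  rw [← setLIntegral_rpow_comp_mul hc (fun l => distFun g μ l.toNNReal ^ (q / p)),
    ← ENNReal.ofReal_rpow_of_pos hc, ← ENNReal.ofReal_rpow_of_pos two_pos, ENNReal.ofReal_ofNat]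
  congr 1
  refine lintegral_congr fun l => ?_
  rw [Real.toNNReal_mul hc.le]
  congr 4
  rw [Real.rpow_intCast, Real.toNNReal_zpow two_pos.le]
  simp

/-- For q = ∞ each dyadic term is at most (B/l)^p. For q < ∞ the bound is raised to the power q/p,
so that 2^{kp} becomes 2^{kq}, exactly the factor absorbed by `lintegral_distFun_dilate`. -/
lemma lorentzNorm_le_of_weakType (hg : AEMeasurable (fun ω => ‖g ω‖ₑ) μ) {p : ℝ} {q : ℝ≥0∞}
    {m : ℕ} (hp : 1 < p) (hm : p < m) (hq : q ≠ 0) {C a : ℝ≥0} (ha : 1 ≤ a)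
    (h : ∀ l : ℝ≥0, l ≠ 0 → distFun f μ (a * l) ≤ C * ∫⁻ ω, minPow m (‖g ω‖ₑ / l) ∂μ) :
    lorentzNorm f p q μ ≤ weakTypeConst p q m (C * a ^ m * 2 ^ m) * lorentzNorm g p q μ := by
  have hp0 : 0 < p := by linarith
  set A : ℝ≥0 := C * a ^ m * 2 ^ m
  set ρ := decayRatio p m
  have key : ∀ l : ℝ≥0, l ≠ 0 → distFun f μ l ≤ A * ∑' k : ℤ, ρ ^ k.natAbs *
      (ρ ^ k.natAbs * ((2 ^ (k : ℝ)) ^ p * distFun g μ (2 ^ k * l))) :=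
    fun l hl => distFun_le_tsum hg hp hm ha h hl
  rcases eq_or_ne q ∞ with rfl | hqt
  · refine lorentzNorm_top_le f μ hp0 fun l hl => (key l hl).trans ?_
    set B := lorentzNorm g p ∞ μ
    have h1 : ∀ k : ℤ, (2 ^ (k : ℝ)) ^ p * distFun g μ (2 ^ k * l) ≤ (B / l) ^ p := fun k => by
      have hT0 : (2 : ℝ≥0∞) ^ (k : ℝ) ≠ 0 := (ENNReal.rpow_pos two_pos ENNReal.ofNat_ne_top).ne'
      have hTt : (2 : ℝ≥0∞) ^ (k : ℝ) ≠ ∞ := by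
        rw [← coe_two_zpow]
        exact ENNReal.coe_ne_top
      refine (mul_le_mul_right (distFun_le_of_lorentzNorm_top g μ hp0
        (mul_ne_zero (zpow_ne_zero _ two_ne_zero) hl)) _).trans_eq ?_
      rw [← ENNReal.mul_rpow_of_nonneg _ _ hp0.le, ENNReal.coe_mul, coe_two_zpow,
        mul_comm _ (l : ℝ≥0∞), div_eq_mul_inv, ENNReal.mul_inv (.inr hTt) (.inr hT0),
        mul_left_comm, mul_left_comm _ (l : ℝ≥0∞)⁻¹, ENNReal.mul_inv_cancel hT0 hTt, mul_one,
        ← div_eq_mul_inv]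
    calc _ ≤ A * ∑' k : ℤ, (ρ * ρ) ^ k.natAbs * (B / l) ^ p := by
          refine mul_le_mul_right (ENNReal.tsum_le_tsum fun k => ?_) _
          rw [mul_pow, mul_assoc]
          gcongr
          exact h1 k
      _ = _ := by
          rw [ENNReal.tsum_mul_right, weakTypeConst, if_pos rfl, mul_div_assoc,
            ENNReal.mul_rpow_of_nonneg _ _ hp0.le, one_div, ENNReal.rpow_inv_rpow hp0.ne',
            mul_assoc]
  · have hq0 : 0 < q.toReal := ENNReal.toReal_pos hq hqt
    set r := q.toReal
    have hθ : 0 < r / p := by positivity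
    have hmd : Measurable (distFun g μ) := (distFun_antitone g μ).measurable
    have h1 : ∀ l : ℝ≥0, l ≠ 0 → distFun f μ l ^ (r / p) ≤
        (A * ∑' k : ℤ, ρ ^ k.natAbs) ^ (r / p) * ∑' k : ℤ, (ρ ^ (r / p)) ^ k.natAbs *
          ((2 ^ (k : ℝ)) ^ r * distFun g μ (2 ^ k * l) ^ (r / p)) := fun l hl => by
      refine (ENNReal.rpow_le_rpow (key l hl) hθ.le).trans ?_
      rw [ENNReal.mul_rpow_of_nonneg _ _ hθ.le, ENNReal.mul_rpow_of_nonneg _ _ hθ.le, mul_assoc]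
      refine mul_le_mul_right ((rpow_tsum_le hθ _ _).trans_eq ?_) _
      congr 1
      refine tsum_congr fun k => ?_
      rw [ENNReal.mul_rpow_of_nonneg _ _ hθ.le, ← ENNReal.rpow_mul _ p, mul_div_cancel₀ _ hp0.ne',
        ← ENNReal.rpow_natCast, ← ENNReal.rpow_natCast, ← ENNReal.rpow_mul,
        ← ENNReal.rpow_mul ρ, mul_comm (r / p)]
    have h2 : ∫⁻ l in Set.Ioi (0 : ℝ), ENNReal.ofReal (l ^ (r - 1)) *
          distFun f μ l.toNNReal ^ (r / p) ≤
        ((A * ∑' k : ℤ, ρ ^ k.natAbs) ^ (r / p) * ∑' k : ℤ, (ρ ^ (r / p)) ^ k.natAbs) *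
          ∫⁻ l in Set.Ioi (0 : ℝ), ENNReal.ofReal (l ^ (r - 1)) *
            distFun g μ l.toNNReal ^ (r / p) := by
      have hmk : ∀ k : ℤ, Measurable fun l : ℝ => ENNReal.ofReal (l ^ (r - 1)) *
          distFun g μ (2 ^ k * l.toNNReal) ^ (r / p) := fun k => by fun_prop
      calc _ ≤ ∫⁻ l in Set.Ioi (0 : ℝ), (A * ∑' k : ℤ, ρ ^ k.natAbs) ^ (r / p) *
            ∑' k : ℤ, (ρ ^ (r / p)) ^ k.natAbs * ((2 ^ (k : ℝ)) ^ r *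
              (ENNReal.ofReal (l ^ (r - 1)) * distFun g μ (2 ^ k * l.toNNReal) ^ (r / p))) := by
            refine setLIntegral_mono' measurableSet_Ioi fun l hl => ?_
            refine (mul_le_mul_right (h1 l.toNNReal (Real.toNNReal_pos.2 hl).ne') _).trans_eq ?_
            rw [mul_left_comm, ← ENNReal.tsum_mul_left (a := ENNReal.ofReal (l ^ (r - 1)))]
            refine congrArg _ (tsum_congr fun k => ?_)
            ring
        _ = _ := by
            rw [lintegral_const_mul _ (by fun_prop), lintegral_tsum fun k => by fun_prop, mul_assoc,
              ← ENNReal.tsum_mul_right]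
            congr 1
            refine tsum_congr fun k => ?_
            rw [lintegral_const_mul _ ((hmk k).const_mul _), lintegral_const_mul _ (hmk k),
              lintegral_distFun_dilate]
    rw [lorentzNorm, lorentzNorm, weakTypeConst, if_neg hqt, if_neg hqt, if_neg hqt,
      lintegral_rearrangement_eq f μ hp0 hq0, lintegral_rearrangement_eq g μ hp0 hq0,
      ← ENNReal.mul_rpow_of_nonneg _ _ (by positivity)]
    refine ENNReal.rpow_le_rpow ?_ (by positivity)
    refine (mul_le_mul_right h2 _).trans_eq ?_
    rw [mul_left_comm]

end WeakTypeToLorentz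

end LorentzMZ

/-! ### The Marcinkiewicz–Zygmund inequality -/

theorem theorem3p5 (p : ℝ) (hp : 1 < p) (q : ℝ≥0∞) (hq : 1 ≤ q) :
    ∃ C : ℝ≥0, 0 < C ∧
      ∀ (𝕜 : Type*) [RCLike 𝕜] (Ω : Type*) [MeasurableSpace Ω]
        (μ : Measure Ω) [IsProbabilityMeasure μ] (N : ℕ) (X : Fin N → Ω → 𝕜),
        iIndepFun X μ →
        (∀ n, Integrable (X n) μ) →
        (∀ n, ∫ ω, X n ω ∂μ = 0) →
          LorentzMZ.lorentzNorm (fun ω => ∑ n, X n ω) p q μ ≤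
              (C : ℝ≥0∞) *
                LorentzMZ.lorentzNorm (fun ω => Real.sqrt (∑ n, ‖X n ω‖ ^ 2)) p q μ ∧
            LorentzMZ.lorentzNorm (fun ω => Real.sqrt (∑ n, ‖X n ω‖ ^ 2)) p q μ ≤
              (C : ℝ≥0∞) * LorentzMZ.lorentzNorm (fun ω => ∑ n, X n ω) p q μ := by
  -- The even Khintchine exponent 2k must exceed p, so that p lies strictly between the endpoints 1
  -- and 2k.
  obtain ⟨k, hk⟩ := exists_nat_gt p
  have hk0 : k ≠ 0 := by rintro rfl; norm_num at hk; linarith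
  have hm : p < (2 * k : ℕ) := by push_cast; linarith
  have hq0 : q ≠ 0 := (zero_lt_one.trans_le hq).ne'
  set M : ℝ≥0 := (2 * √(2 * LorentzMZ.khintchineConst 2)).toNNReal with hM
  have hM1 : 1 ≤ M := by
    rw [hM, ← Real.toNNReal_one]
    refine Real.toNNReal_mono ?_
    have : 1 ≤ √(2 * LorentzMZ.khintchineConst 2) := by
      rw [Real.one_le_sqrt]
      linarith [LorentzMZ.one_le_khintchineConst 2]
    linarith
  set K : ℝ≥0 := 2 * (LorentzMZ.khintchineConst k).toNNReal
  set C₁ := LorentzMZ.weakTypeConst p q (2 * k) (K * 3 ^ (2 * k) * 2 ^ (2 * k))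
  set C₂ := LorentzMZ.weakTypeConst p q (2 * k) (2 * (3 * M) ^ (2 * k) * 2 ^ (2 * k))
  have hC₁ : C₁ ≠ ∞ := LorentzMZ.weakTypeConst_ne_top hp hm hq0 _
  have hC₂ : C₂ ≠ ∞ := LorentzMZ.weakTypeConst_ne_top hp hm hq0 _
  -- The summand 1 only ensures positivity.
  refine ⟨C₁.toNNReal + C₂.toNNReal + 1, by positivity, ?_⟩
  intro 𝕜 _ Ω _ μ _ N X hX hint h0
  have hae := fun n => (hint n).aestronglyMeasurable.aemeasurable
  have hle₁ : C₁ ≤ (C₁.toNNReal + C₂.toNNReal + 1 : ℝ≥0) := by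
    rw [ENNReal.coe_add, ENNReal.coe_add, ENNReal.coe_toNNReal hC₁, add_assoc]
    exact le_self_add
  have hle₂ : C₂ ≤ (C₁.toNNReal + C₂.toNNReal + 1 : ℝ≥0) := by
    rw [ENNReal.coe_add, ENNReal.coe_add, ENNReal.coe_toNNReal hC₂, add_right_comm]
    exact le_add_self
  constructor
  · refine le_trans (LorentzMZ.lorentzNorm_le_of_weakType (C := K) (a := 3)
      (LorentzMZ.aemeasurable_squareFun hae).enorm hp hm hq0 (by norm_num) fun l hl => ?_)
      (mul_le_mul_left hle₁ _)
    refine (LorentzMZ.distFun_sum_le hX hint h0 hk0 hl).trans_eq ?_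
    rw [ENNReal.coe_mul]
    rfl
  · refine le_trans (LorentzMZ.lorentzNorm_le_of_weakType (C := 2) (a := 3 * M)
      (Finset.aemeasurable_fun_sum _ fun n _ => hae n).enorm hp hm hq0 ?_ fun l hl =>
        LorentzMZ.distFun_squareFun_le hX hint h0 hk0 hl) (mul_le_mul_left hle₂ _)
    exact one_le_mul_of_one_le_of_one_le (by norm_num) hM1
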